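/- **Proposition.** Let $n \ge 2$ and let $P \subset \mathbb{H}^n$ be a (compact, possibly non-convex, possibly degenerate) polytope in hyperbolic $n$-space with facets $F_1,\dots,F_m$ ($m\ge 1$), of areas (i.e. $(n-1)$-dimensional hyperbolic volumes) $S_m \ge S_{m-1} \ge \dots \ge S_1 > 0$. Then $$S_m \le \sum_{i=1}^{m-1} S_i ,$$ with equality if and only if $P$ degenerates into the doubly counted facet $F_m$, that is, $P = F_m$ as a point set and the other facets $F_1,\dots,F_{m-1}$ cover $F_m$ exactly once: $\bigcup_{i<m} F_i = F_m$, and $F_i \cap F_j$ has area $0$ for $i<j<m$. Here each facet $F_i$ is a finite union of $(n-1)$-dimensional compact convex polytopes in one hyperplane. The solid part $R$ of $P$, i.e. the closure of the interior of $P$, is a finite (possibly empty) union of $n$-dimensional compact convex polytopes; $P = R \cup F_1 \cup \dots \cup F_m$ and $\partial R \subset F_1 \cup \dots \cup F_m$. Up to sets of $(n-1)$-dimensional measure $0$, a point of $\partial R$ lies on an odd number of facets and any other point on an even number. (A non-degenerate polytope has $P=R$, and its facets cover $\partial P$ without overlapping; flat portions of a degenerate polytope are counted from both sides.) -/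

import Mathlib

open MeasureTheory

noncomputable section

/-- The Lorentz form `⟨u, v⟩ = u₁ v₁ + ⋯ + uₙ vₙ - u₀ v₀` on `ℝ × ℝⁿ`, where `u₀ = u.1` is the
time coordinate and `u.2 = (u₁, …, uₙ)`. -/
def lorentz {n : ℕ} (u v : ℝ × EuclideanSpace ℝ (Fin n)) : ℝ :=
  inner ℝ u.2 v.2 - u.1 * v.1

/-- Hyperbolic `n`-space, as the upper sheet `⟨x, x⟩ = -1`, `x₀ > 0` of the hyperboloid. -/
@[ext]
structure HyperbolicSpace (n : ℕ) where
  vec : ℝ × EuclideanSpace ℝ (Fin n)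
  lorentz_self : lorentz vec vec = -1
  time_pos : 0 < vec.1

namespace HyperbolicSpace

variable {n : ℕ}

/-- The hyperbolic distance: `cosh (dist x y) = -⟨x, y⟩`. -/
instance : Dist (HyperbolicSpace n) :=
  ⟨fun x y => Real.arcosh (-lorentz x.vec y.vec)⟩

theorem dist_def (x y : HyperbolicSpace n) :
    dist x y = Real.arcosh (-lorentz x.vec y.vec) := rfl

theorem lorentz_comm (u v : ℝ × EuclideanSpace ℝ (Fin n)) : lorentz u v = lorentz v u := by
  unfold lorentz
  rw [real_inner_comm, mul_comm]

theorem lorentz_comb_left (s t : ℝ) (u v w : ℝ × EuclideanSpace ℝ (Fin n)) :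
    lorentz (s • u + t • v) w = s * lorentz u w + t * lorentz v w := by
  simp only [lorentz, Prod.fst_add, Prod.snd_add, Prod.smul_fst, Prod.smul_snd, inner_add_left,
    real_inner_smul_left, smul_eq_mul]
  ring

theorem lorentz_comb_right (s t : ℝ) (u v w : ℝ × EuclideanSpace ℝ (Fin n)) :
    lorentz w (s • u + t • v) = s * lorentz w u + t * lorentz w v := by
  rw [lorentz_comm, lorentz_comb_left, lorentz_comm u, lorentz_comm v]

theorem norm_sq_space (x : HyperbolicSpace n) : ‖x.vec.2‖ ^ 2 = x.vec.1 ^ 2 - 1 := by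
  have h := x.lorentz_self
  unfold lorentz at h
  rw [real_inner_self_eq_norm_sq] at h
  linarith [sq x.vec.1]

theorem norm_space_lt (x : HyperbolicSpace n) : ‖x.vec.2‖ < x.vec.1 := by
  have h := norm_sq_space x
  exact lt_of_pow_lt_pow_left₀ 2 x.time_pos.le (by linarith)

theorem one_le_neg_lorentz (x y : HyperbolicSpace n) : 1 ≤ -lorentz x.vec y.vec := by
  have hx := norm_sq_space x
  have hy := norm_sq_space y
  have h1 := real_inner_le_norm x.vec.2 y.vec.2
  have h2 : ‖x.vec.2‖ * ‖y.vec.2‖ ≤ x.vec.1 * y.vec.1 - 1 := by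
    have hxy : 1 ≤ x.vec.1 * y.vec.1 := by
      have h3 : 1 ≤ x.vec.1 := by nlinarith [x.time_pos, sq_nonneg ‖x.vec.2‖]
      have h4 : 1 ≤ y.vec.1 := by nlinarith [y.time_pos, sq_nonneg ‖y.vec.2‖]
      nlinarith
    apply le_of_sq_le_sq _ (by linarith)
    rw [mul_pow, hx, hy]
    nlinarith [sq_nonneg (x.vec.1 - y.vec.1)]
  unfold lorentz
  linarith

/-- The Lorentz form is nonnegative on the orthogonal complement of a point. -/
theorem lorentz_nonneg_of_orthogonal (y : HyperbolicSpace n)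
    (w : ℝ × EuclideanSpace ℝ (Fin n)) (hw : lorentz w y.vec = 0) : 0 ≤ lorentz w w := by
  have hy := norm_sq_space y
  have h1 : (w.1 * y.vec.1) ^ 2 ≤ ‖w.2‖ ^ 2 * ‖y.vec.2‖ ^ 2 := by
    unfold lorentz at hw
    have h2 : w.1 * y.vec.1 = inner ℝ w.2 y.vec.2 := by linarith
    rw [h2, ← mul_pow, ← sq_abs]
    exact pow_le_pow_left₀ (abs_nonneg _) (abs_real_inner_le_norm _ _) 2
  unfold lorentz
  rw [real_inner_self_eq_norm_sq]
  have h3 : (w.1 * w.1) * y.vec.1 ^ 2 ≤ ‖w.2‖ ^ 2 * y.vec.1 ^ 2 := by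
    nlinarith [sq_nonneg ‖w.2‖]
  have h4 : 0 < y.vec.1 ^ 2 := pow_pos y.time_pos 2
  linarith [le_of_mul_le_mul_right h3 h4]

theorem triangle_aux (x y z : HyperbolicSpace n) :
    Real.arcosh (-lorentz x.vec z.vec) ≤
      Real.arcosh (-lorentz x.vec y.vec) + Real.arcosh (-lorentz y.vec z.vec) := by
  have hp := one_le_neg_lorentz x y
  have hq := one_le_neg_lorentz y z
  have hr := one_le_neg_lorentz x z
  set p := -lorentz x.vec y.vec with hpd
  set q := -lorentz y.vec z.vec with hqd
  set r := -lorentz x.vec z.vec with hrd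
  have hxy : lorentz x.vec y.vec = -p := by linarith
  have hyz : lorentz y.vec z.vec = -q := by linarith
  have hxz : lorentz x.vec z.vec = -r := by linarith
  have key : (p * q - r) ^ 2 ≤ (p ^ 2 - 1) * (q ^ 2 - 1) := by
    have hquad : ∀ s : ℝ, 0 ≤ (p ^ 2 - 1) * (s * s) + (2 * (p * q - r)) * s + (q ^ 2 - 1) := by
      intro s
      have h := lorentz_nonneg_of_orthogonal y
        (1 • (s • x.vec + (1 : ℝ) • z.vec) + (-(s * p) - q) • y.vec) (by
          rw [one_smul, ← one_smul ℝ (s • x.vec + (1 : ℝ) • z.vec), lorentz_comb_left,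
            lorentz_comb_left, lorentz_comm z.vec, hxy, hyz, y.lorentz_self]
          ring)
      rw [one_smul, ← one_smul ℝ (s • x.vec + (1 : ℝ) • z.vec)] at h
      simp only [lorentz_comb_left, lorentz_comb_right] at h
      rw [lorentz_comm z.vec x.vec, lorentz_comm z.vec y.vec, lorentz_comm y.vec x.vec,
        hxy, hyz, hxz, x.lorentz_self, y.lorentz_self, z.lorentz_self] at h
      nlinarith
    have h := discrim_le_zero hquad
    unfold discrim at h
    nlinarith
  have hcosh : r ≤ Real.cosh (Real.arcosh p + Real.arcosh q) := by
    rw [Real.cosh_add, Real.cosh_arcosh hp, Real.cosh_arcosh hq, Real.sinh_arcosh hp,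
      Real.sinh_arcosh hq, ← Real.sqrt_mul (by nlinarith)]
    have h := Real.abs_le_sqrt key
    linarith [neg_abs_le (p * q - r)]
  calc Real.arcosh r ≤ Real.arcosh (Real.cosh (Real.arcosh p + Real.arcosh q)) :=
        (Real.arcosh_le_arcosh (by linarith) (Real.cosh_pos _)).2 hcosh
    _ = _ := Real.arcosh_cosh (add_nonneg (Real.arcosh_nonneg hp) (Real.arcosh_nonneg hq))

instance : MetricSpace (HyperbolicSpace n) where
  dist_self x := by rw [dist_def, x.lorentz_self, neg_neg, Real.arcosh_zero]
  dist_comm x y := by rw [dist_def, dist_def, lorentz_comm]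
  dist_triangle x y z := by simpa only [dist_def] using triangle_aux x y z
  eq_of_dist_eq_zero := by
    intro x y h
    rw [dist_def, Real.arcosh_eq_zero_iff (one_le_neg_lorentz x y)] at h
    have hx := norm_sq_space x
    have hy := norm_sq_space y
    have hi : inner ℝ x.vec.2 y.vec.2 = x.vec.1 * y.vec.1 - 1 := by
      unfold lorentz at h
      linarith
    have h1 : (x.vec.1 * y.vec.1 - 1) ^ 2 ≤ (x.vec.1 ^ 2 - 1) * (y.vec.1 ^ 2 - 1) := by
      rw [← hi, ← hx, ← hy, ← mul_pow, ← sq_abs]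
      exact pow_le_pow_left₀ (abs_nonneg _) (abs_real_inner_le_norm _ _) 2
    have h2 : x.vec.1 = y.vec.1 := by nlinarith [sq_nonneg (x.vec.1 - y.vec.1)]
    have h3 : ‖x.vec.2 - y.vec.2‖ ^ 2 = 0 := by
      rw [norm_sub_sq_real, hx, hy, hi, h2]
      ring
    have h4 : x.vec.2 = y.vec.2 := sub_eq_zero.1 (norm_eq_zero.1 (pow_eq_zero_iff two_ne_zero |>.1 h3))
    exact HyperbolicSpace.ext (Prod.ext h2 h4)

instance : MeasurableSpace (HyperbolicSpace n) := borel _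

instance : BorelSpace (HyperbolicSpace n) := ⟨rfl⟩

/-- The hyperbolic `d`-dimensional volume of a set: the Hausdorff measure of the hyperbolic
metric, multiplied by the volume of a Euclidean `d`-ball of diameter `1`. With this factor it is
the Riemannian `d`-volume for subsets of `d`-dimensional planes. -/
def hVolume (d : ℕ) (A : Set (HyperbolicSpace n)) : ENNReal :=
  volume (Metric.ball (0 : EuclideanSpace ℝ (Fin d)) (1 / 2)) * Measure.hausdorffMeasure d A

/-- Hyperplanes of hyperbolic space: the nonempty intersections with linear hyperplanes, that is,
with the Lorentz-orthogonal complements of spacelike vectors. -/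
def IsHyperplane (h : Set (HyperbolicSpace n)) : Prop :=
  ∃ ν : ℝ × EuclideanSpace ℝ (Fin n), 0 < lorentz ν ν ∧ h = {x | lorentz x.vec ν = 0}

/-- The (geodesic) convex hull of finitely many points: the points of the hyperboloid in the
convex cone generated by the given points. -/
def hull (V : Finset (HyperbolicSpace n)) : Set (HyperbolicSpace n) :=
  {x | ∃ c : HyperbolicSpace n → ℝ, (∀ v ∈ V, 0 ≤ c v) ∧ x.vec = ∑ v ∈ V, c v • v.vec}

/-- `d`-dimensional compact convex polytopes: convex hulls of finitely many points that span a
`d`-dimensional plane. -/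
def IsConvexPolytope (d : ℕ) (A : Set (HyperbolicSpace n)) : Prop :=
  ∃ V : Finset (HyperbolicSpace n),
    Module.finrank ℝ (Submodule.span ℝ (HyperbolicSpace.vec '' (V : Set (HyperbolicSpace n)))) =
      d + 1 ∧
    A = hull V

/-- Finite (possibly empty) unions of `d`-dimensional compact convex polytopes. -/
def IsPolyhedral (d : ℕ) (A : Set (HyperbolicSpace n)) : Prop :=
  ∃ C : Set (Set (HyperbolicSpace n)), C.Finite ∧ (∀ K ∈ C, IsConvexPolytope d K) ∧ A = ⋃₀ C

/-- A polytope in hyperbolic `n`-space with `m` labelled facets. It need not be convex, and it may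
be degenerate.

The set `carrier` is the polytope as a point set, and `closure (interior carrier)` is its solid
part. For a non-degenerate polytope the solid part is everything and the facets cover its
boundary without overlapping. In a degenerate polytope there are also flat portions, which belong
to facets on both of their sides; the solid part may then even be empty. Thus for almost every
point, the number of facets through it is odd if the point is on the boundary of the solid part
(one facet, plus an even number when flat layers are pressed against it), and it is even
otherwise. -/
structure Polytope (n m : ℕ) where
  carrier : Set (HyperbolicSpace n)
  facet : Fin m → Set (HyperbolicSpace n)
  solid_polyhedral : IsPolyhedral n (closure (interior carrier))
  facet_polyhedral : ∀ i, IsPolyhedral (n - 1) (facet i)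
  facet_in_hyperplane : ∀ i, ∃ h, IsHyperplane h ∧ facet i ⊆ h
  carrier_eq : carrier = closure (interior carrier) ∪ ⋃ i, facet i
  frontier_subset : frontier (closure (interior carrier)) ⊆ ⋃ i, facet i
  facet_parity : ∀ᵐ x ∂(Measure.hausdorffMeasure ((n - 1 : ℕ) : ℝ) : Measure (HyperbolicSpace n)),
    Odd {i | x ∈ facet i}.ncard ↔ x ∈ frontier (closure (interior carrier))

namespace Polytope

variable {m : ℕ}

/-- The area, that is, the `(n - 1)`-volume, of a facet. -/
def facetArea (P : Polytope n m) (i : Fin m) : ENNReal := hVolume (n - 1) (P.facet i)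

/-- `P` degenerates into its doubly counted facet number `k`: as a set, `P` is that facet (in
particular it lies in a hyperplane), and the other facets cover this facet
once more, without overlapping each other. -/
def IsDoublyCountedFacet (P : Polytope n m) (k : Fin m) : Prop :=
  P.carrier = P.facet k ∧ (⋃ i ∈ {i | i ≠ k}, P.facet i) = P.facet k ∧
    ∀ i j, i ≠ k → j ≠ k → i ≠ j → hVolume (n - 1) (P.facet i ∩ P.facet j) = 0

end Polytope

end HyperbolicSpace

end

namespace HyperbolicSpace

variable {n : ℕ}

/-! Project everything orthogonally onto the hyperplane of a facet `F_k`. This map is 1-Lipschitz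
(`cosh_dist_proj_le`), so it does not increase `(n-1)`-dimensional Hausdorff measure, and the
inequality follows once the projections of the other facets cover `F_k`
(`facet_subset_biUnion_image_proj`). Suppose they miss a point of `F_k`. The projections form a
closed set, so an open cylinder of normal lines around that point meets no facet but `F_k`. Almost
every point of `F_k` in the cylinder then lies on exactly one facet, and parity puts it on the
boundary of the solid part. Nearby there is an interior point off the hyperplane. The normal line
through it, followed away from the hyperplane, leaves the bounded solid part through a facet other
than `F_k` inside the cylinder, a contradiction.

For equality, the projection is locally a strict contraction off the hyperplane
(`exists_lipschitzOnWith_proj`), and a polyhedral set has positive measure near each of its points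
(`hausdorffMeasure_hull_inter_pos`, by way of the Klein chart). A facet that leaves the hyperplane
would therefore make the inequality strict. Once all facets lie in the hyperplane, the solid part is
empty and only measure theory remains. -/

/-! ### Lorentz algebra and the topology of the hyperboloid. -/

theorem lorentz_smul_left (s : ℝ) (u v : ℝ × EuclideanSpace ℝ (Fin n)) :
    lorentz (s • u) v = s * lorentz u v := by
  simpa using lorentz_comb_left s 0 u u v

theorem lorentz_smul_right (s : ℝ) (u v : ℝ × EuclideanSpace ℝ (Fin n)) :
    lorentz u (s • v) = s * lorentz u v := by
  simpa using lorentz_comb_right s 0 v v u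

theorem lorentz_sub_left (u v w : ℝ × EuclideanSpace ℝ (Fin n)) :
    lorentz (u - v) w = lorentz u w - lorentz v w := by
  simpa [sub_eq_add_neg] using lorentz_comb_left 1 (-1) u v w

theorem lorentz_sub_right (u v w : ℝ × EuclideanSpace ℝ (Fin n)) :
    lorentz u (v - w) = lorentz u v - lorentz u w := by
  simpa [sub_eq_add_neg] using lorentz_comb_right 1 (-1) v w u

theorem cosh_dist (x y : HyperbolicSpace n) :
    Real.cosh (dist x y) = -lorentz x.vec y.vec := by
  rw [dist_def, Real.cosh_arcosh (one_le_neg_lorentz x y)]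

theorem continuous_lorentz :
    Continuous fun p : (ℝ × EuclideanSpace ℝ (Fin n)) × (ℝ × EuclideanSpace ℝ (Fin n)) =>
      lorentz p.1 p.2 := by
  unfold lorentz
  fun_prop

theorem _root_.Continuous.lorentz {X : Type*} [TopologicalSpace X]
    {f g : X → ℝ × EuclideanSpace ℝ (Fin n)} (hf : Continuous f) (hg : Continuous g) :
    Continuous fun x => lorentz (f x) (g x) :=
  continuous_lorentz.comp (hf.prodMk hg)

/-- A timelike vector that pairs negatively with a point is future-directed. -/
theorem fst_pos_of_lorentz_neg (x : HyperbolicSpace n) {w : ℝ × EuclideanSpace ℝ (Fin n)}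
    (hw : lorentz w w < 0) (h : lorentz w x.vec < 0) : 0 < w.1 := by
  by_contra! h0
  have h1 : ‖w.2‖ ≤ -w.1 := by
    unfold lorentz at hw
    rw [real_inner_self_eq_norm_sq] at hw
    exact le_of_sq_le_sq (by nlinarith) (by linarith)
  have h2 := (abs_le.1 (abs_real_inner_le_norm w.2 x.vec.2)).1
  have h3 := norm_space_lt x
  unfold lorentz at h
  nlinarith [norm_nonneg w.2, norm_nonneg x.vec.2, x.time_pos,
    mul_le_mul h1 h3.le (norm_nonneg _) (by linarith)]

/-- Maps into hyperbolic space are continuous if they are so in the ambient space. -/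
theorem continuous_of_continuous_vec {X : Type*} [TopologicalSpace X] {f : X → HyperbolicSpace n}
    (hf : Continuous fun x => (f x).vec) : Continuous f := by
  refine continuous_iff_continuousAt.2 fun a => tendsto_iff_dist_tendsto_zero.2 ?_
  have h1 : Continuous fun x => dist (f x) (f a) := by
    simp only [dist_def]
    exact Real.continuousOn_arcosh.comp_continuous
      (hf.lorentz continuous_const).neg fun x => one_le_neg_lorentz _ _
  simpa using h1.tendsto a

/-- The point `(1, 0, …, 0)`. -/
def origin : HyperbolicSpace n where
  vec := (1, 0)
  lorentz_self := by simp [lorentz]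
  time_pos := one_pos

theorem cosh_dist_origin (x : HyperbolicSpace n) : Real.cosh (dist x origin) = x.vec.1 := by
  simp [cosh_dist, lorentz, origin]

theorem continuous_time : Continuous fun x : HyperbolicSpace n => x.vec.1 := by
  simp only [← cosh_dist_origin]
  fun_prop

/-- With continuity of the time coordinate, this makes the embedding into the ambient space
continuous for the hyperbolic metric. -/
theorem norm_space_sub_sq (x y : HyperbolicSpace n) :
    ‖x.vec.2 - y.vec.2‖ ^ 2 = 2 * (Real.cosh (dist x y) - 1) + (x.vec.1 - y.vec.1) ^ 2 := by
  rw [norm_sub_sq_real, norm_sq_space, norm_sq_space, cosh_dist, lorentz]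
  ring

theorem continuous_vec : Continuous (vec : HyperbolicSpace n → _) := by
  refine continuous_time.prodMk (continuous_iff_continuousAt.2 fun y => ?_)
  refine tendsto_iff_norm_sub_tendsto_zero.2 ?_
  have h1 : Continuous fun x : HyperbolicSpace n =>
      √(2 * (Real.cosh (dist x y) - 1) + (x.vec.1 - y.vec.1) ^ 2) := by
    have := continuous_time (n := n)
    fun_prop
  have h2 := h1.tendsto y
  simp only [← norm_space_sub_sq, Real.sqrt_sq (norm_nonneg _)] at h2
  simpa using h2

/-! ### Estimates for `cosh`, and crossing a frontier. -/

theorem _root_.Real.sq_half_le_cosh_sub_one (t : ℝ) : t ^ 2 / 2 ≤ Real.cosh t - 1 := by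
  wlog ht : 0 ≤ t generalizing t
  · simpa using this (-t) (by linarith)
  have h1 : Real.cosh t = 1 + 2 * Real.sinh (t / 2) ^ 2 := by
    have h2 := Real.cosh_two_mul (t / 2)
    have h3 := Real.cosh_sq (t / 2)
    rw [mul_div_cancel₀ t two_ne_zero] at h2
    linarith
  have h2 : t / 2 ≤ Real.sinh (t / 2) := Real.self_le_sinh_iff.2 (by linarith)
  nlinarith

theorem _root_.Real.cosh_sub_one_le {t : ℝ} (ht : t ^ 2 ≤ 2) :
    Real.cosh t - 1 ≤ t ^ 2 / 2 * (1 + t ^ 2 / 2) := by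
  have h1 := Real.cosh_le_exp_half_sq t
  have h2 := Real.abs_exp_sub_one_sub_id_le (x := t ^ 2 / 2)
    (by rw [abs_of_nonneg (by positivity)]; linarith)
  have h3 := (abs_le.1 h2).2
  nlinarith

/-- Off the frontier, space splits into the disjoint open sets `interior R` and `(closure R)ᶜ`, and
a preconnected set cannot meet both while lying in their union. -/
theorem _root_.IsPreconnected.inter_frontier_nonempty {X : Type*} [TopologicalSpace X]
    {T R : Set X} (hT : IsPreconnected T) (h1 : (T ∩ R).Nonempty) (h2 : (T ∩ Rᶜ).Nonempty) :
    (T ∩ frontier R).Nonempty := by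
  by_contra h
  have hcov : T ⊆ interior R ∪ (closure R)ᶜ := fun x hx => by
    by_contra hx'
    rw [Set.mem_union, not_or, Set.notMem_compl_iff] at hx'
    exact h ⟨x, hx, hx'.2, hx'.1⟩
  obtain ⟨a, ha, haR⟩ := h1
  obtain ⟨b, hb, hbR⟩ := h2
  obtain ⟨z, -, hz1, hz2⟩ := hT _ _ isOpen_interior isClosed_closure.isOpen_compl hcov
    ⟨a, ha, (hcov ha).resolve_right fun h' => h' (subset_closure haR)⟩
    ⟨b, hb, (hcov hb).resolve_left fun h' => hbR (interior_subset h')⟩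
  exact hz2 (subset_closure (interior_subset hz1))

/-! ### Orthogonal projection onto a hyperplane, and its normal lines. -/

section Projection

variable {e : ℝ × EuclideanSpace ℝ (Fin n)} (he : lorentz e e = 1)

/-- The nearest-point projection onto the hyperplane orthogonal to the unit vector `e`. -/
noncomputable def proj (x : HyperbolicSpace n) : HyperbolicSpace n where
  vec := (√(1 + lorentz x.vec e ^ 2))⁻¹ • (x.vec - lorentz x.vec e • e)
  lorentz_self := by
    have h := Real.sq_sqrt (x := 1 + lorentz x.vec e ^ 2) (by positivity)
    have h0 : 0 < √(1 + lorentz x.vec e ^ 2) := Real.sqrt_pos.2 (by positivity)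
    simp only [lorentz_smul_left, lorentz_smul_right, lorentz_sub_left, lorentz_sub_right, he,
      x.lorentz_self, lorentz_comm e x.vec]
    field_simp
    rw [h]
    ring
  time_pos := by
    refine mul_pos (inv_pos.2 (Real.sqrt_pos.2 (by positivity)))
      (fst_pos_of_lorentz_neg (w := x.vec - lorentz x.vec e • e) x ?_ ?_) <;>
    · simp only [lorentz_smul_left, lorentz_smul_right, lorentz_sub_left, lorentz_sub_right, he,
        x.lorentz_self, lorentz_comm e x.vec]
      nlinarith [sq_nonneg (lorentz x.vec e)]

theorem lorentz_proj (x : HyperbolicSpace n) : lorentz (proj he x).vec e = 0 := by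
  simp [proj, lorentz_smul_left, lorentz_sub_left, he]

theorem proj_eq_self {x : HyperbolicSpace n} (hx : lorentz x.vec e = 0) : proj he x = x := by
  ext1
  simp [proj, hx]

/-- The projection contracts more strongly away from the hyperplane. -/
theorem cosh_dist_proj_le (x y : HyperbolicSpace n) :
    √(1 + lorentz x.vec e ^ 2) * √(1 + lorentz y.vec e ^ 2) *
      (Real.cosh (dist (proj he x) (proj he y)) - 1) ≤ Real.cosh (dist x y) - 1 := by
  have hx0 : 0 < √(1 + lorentz x.vec e ^ 2) := Real.sqrt_pos.2 (by positivity)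
  have hy0 : 0 < √(1 + lorentz y.vec e ^ 2) := Real.sqrt_pos.2 (by positivity)
  -- Cauchy–Schwarz for the vectors `(1, ⟨x, e⟩)` and `(1, ⟨y, e⟩)`.
  have h : 1 + lorentz x.vec e * lorentz y.vec e ≤
      √(1 + lorentz x.vec e ^ 2) * √(1 + lorentz y.vec e ^ 2) := by
    rw [← Real.sqrt_mul (by positivity)]
    exact Real.le_sqrt_of_sq_le (by nlinarith [sq_nonneg (lorentz x.vec e - lorentz y.vec e)])
  have h1 : √(1 + lorentz x.vec e ^ 2) * √(1 + lorentz y.vec e ^ 2) *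
      Real.cosh (dist (proj he x) (proj he y)) =
        -lorentz x.vec y.vec + lorentz x.vec e * lorentz y.vec e := by
    rw [cosh_dist]
    simp only [proj, lorentz_smul_left, lorentz_smul_right, lorentz_sub_left, lorentz_sub_right, he,
      lorentz_comm e y.vec]
    field_simp
    ring
  rw [mul_sub, h1, cosh_dist]
  linarith

theorem dist_proj_le (x y : HyperbolicSpace n) : dist (proj he x) (proj he y) ≤ dist x y := by
  have h := cosh_dist_proj_le he x y
  have h1 : 1 ≤ √(1 + lorentz x.vec e ^ 2) := Real.one_le_sqrt.2 (by nlinarith)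
  have h2 : 1 ≤ √(1 + lorentz y.vec e ^ 2) := Real.one_le_sqrt.2 (by nlinarith)
  have h3 := Real.one_le_cosh (dist (proj he x) (proj he y))
  have h4 : Real.cosh (dist (proj he x) (proj he y)) ≤ Real.cosh (dist x y) := by
    nlinarith [one_le_mul_of_one_le_of_one_le h1 h2]
  simpa [abs_of_nonneg dist_nonneg] using Real.cosh_le_cosh.1 h4

theorem lipschitzWith_proj : LipschitzWith 1 (proj he) :=
  LipschitzWith.of_dist_le_mul fun x y => by simpa using dist_proj_le he x y

/-- Away from the hyperplane the projection is locally a strict contraction. -/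
theorem exists_lipschitzOnWith_proj {x : HyperbolicSpace n} (hx : lorentz x.vec e ≠ 0) :
    ∃ r > 0, ∃ K : NNReal, K < 1 ∧ LipschitzOnWith K (proj he) (Metric.closedBall x r) := by
  set q := lorentz x.vec e ^ 2 / 2 with hq
  have hq0 : 0 < q := by positivity
  have hopen : IsOpen {y : HyperbolicSpace n | q < lorentz y.vec e ^ 2} :=
    isOpen_lt continuous_const ((continuous_vec.lorentz continuous_const).pow 2)
  obtain ⟨δ, hδ, hball⟩ := Metric.isOpen_iff.1 hopen x (by
    change q < lorentz x.vec e ^ 2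
    linarith)
  -- `ρ` bounds the diameter of the ball of radius `ρ / 2`. From `ρ ≤ 1` and `ρ ≤ q` squared
  -- distances are at most `q`, so the error factor `1 + d²/2` in the bound for `cosh` is at most `1
  -- + q/2`, less than the gain `1 + q`. The contraction constant is the root of their quotient.
  set ρ := min 1 (min (δ / 2) q) with hρ
  have hρ0 : 0 < ρ := by positivity
  have hρ1 : ρ ≤ 1 := min_le_left _ _
  have hρδ : ρ ≤ δ / 2 := (min_le_right _ _).trans (min_le_left _ _)
  have hρq : ρ ≤ q := (min_le_right _ _).trans (min_le_right _ _)
  have hK0 : 0 ≤ (1 + q / 2) / (1 + q) := by positivity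
  refine ⟨ρ / 2, by positivity, (√((1 + q / 2) / (1 + q))).toNNReal, ?_, ?_⟩
  · rw [Real.toNNReal_lt_one, Real.sqrt_lt' one_pos, div_lt_iff₀ (by positivity)]
    linarith
  refine LipschitzOnWith.of_dist_le_mul fun y hy z hz => ?_
  rw [Real.coe_toNNReal _ (Real.sqrt_nonneg _)]
  have hsub : Metric.closedBall x (ρ / 2) ⊆ Metric.ball x δ :=
    Metric.closedBall_subset_ball (by linarith)
  have hy1 : q < lorentz y.vec e ^ 2 := hball (hsub hy)
  have hz1 : q < lorentz z.vec e ^ 2 := hball (hsub hz)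
  have hd : dist y z ≤ ρ := by
    have := dist_triangle_right y z x
    rw [Metric.mem_closedBall] at hy hz
    linarith
  have hd0 : 0 ≤ dist y z := dist_nonneg
  have hd2 : dist y z ^ 2 ≤ q := by nlinarith
  have hc : 1 + q ≤ √(1 + lorentz y.vec e ^ 2) * √(1 + lorentz z.vec e ^ 2) := by
    rw [← Real.sqrt_mul (by positivity)]
    refine Real.le_sqrt_of_sq_le ?_
    rw [sq]
    exact mul_le_mul (by linarith) (by linarith) (by positivity) (by positivity)
  have h1 := cosh_dist_proj_le he y z
  have h2 := Real.sq_half_le_cosh_sub_one (dist (proj he y) (proj he z))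
  have h3 := Real.cosh_sub_one_le (t := dist y z) (by nlinarith)
  have h4 : (1 + q) * dist (proj he y) (proj he z) ^ 2 ≤ (1 + q / 2) * dist y z ^ 2 := by
    have h5 : (1 + q) * (dist (proj he y) (proj he z) ^ 2 / 2) ≤
        dist y z ^ 2 / 2 * (1 + dist y z ^ 2 / 2) :=
      (mul_le_mul hc h2 (by positivity) (by positivity)).trans (h1.trans h3)
    nlinarith [sq_nonneg (dist y z)]
  refine le_of_sq_le_sq ?_ (by positivity)
  rw [mul_pow, Real.sq_sqrt hK0, div_mul_eq_mul_div, le_div_iff₀ (by positivity)]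
  linarith

/-- The point at signed distance `s` from `p` on the normal line at `p` to the hyperplane
orthogonal to `e`. -/
noncomputable def normalPoint (p : HyperbolicSpace n) (hp : lorentz p.vec e = 0) (s : ℝ) :
    HyperbolicSpace n where
  vec := Real.cosh s • p.vec + Real.sinh s • e
  lorentz_self := by
    simp only [lorentz_comb_left, lorentz_comb_right, he, hp, p.lorentz_self, lorentz_comm e p.vec]
    linarith [Real.cosh_sq s]
  time_pos := by
    refine fst_pos_of_lorentz_neg p ?_ ?_ <;>
      simp only [lorentz_comb_left, lorentz_comb_right, he, hp, p.lorentz_self,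
        lorentz_comm e p.vec]
    · linarith [Real.cosh_sq s]
    · linarith [Real.cosh_pos s]

variable {p : HyperbolicSpace n} (hp : lorentz p.vec e = 0)

theorem lorentz_normalPoint (s : ℝ) : lorentz (normalPoint he p hp s).vec e = Real.sinh s := by
  simp [normalPoint, lorentz_comb_left, hp, he]

theorem proj_normalPoint (s : ℝ) : proj he (normalPoint he p hp s) = p := by
  ext1
  have h : 1 + Real.sinh s ^ 2 = Real.cosh s ^ 2 := by rw [Real.cosh_sq]; ring
  simp only [proj, lorentz_normalPoint, h, Real.sqrt_sq (Real.cosh_pos s).le]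
  simp [normalPoint, smul_smul, inv_mul_cancel₀ (Real.cosh_pos s).ne']

theorem continuous_normalPoint : Continuous (normalPoint he p hp) := by
  refine continuous_of_continuous_vec ?_
  simp only [normalPoint]
  fun_prop

theorem dist_normalPoint (s : ℝ) : dist (normalPoint he p hp s) p = |s| := by
  refine Real.cosh_strictMonoOn.injOn (Set.mem_Ici.2 dist_nonneg)
    (Set.mem_Ici.2 (abs_nonneg s)) ?_
  rw [cosh_dist, Real.cosh_abs]
  simp [normalPoint, lorentz_comb_left, lorentz_comm e p.vec, hp, p.lorentz_self]

theorem normalPoint_proj (x : HyperbolicSpace n) :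
    normalPoint he (proj he x) (lorentz_proj he x) (Real.arsinh (lorentz x.vec e)) = x := by
  ext1
  have h0 : 0 < √(1 + lorentz x.vec e ^ 2) := Real.sqrt_pos.2 (by positivity)
  simp [mul_inv_cancel₀ h0.ne', normalPoint, proj, Real.cosh_arsinh, smul_smul]

/-- The hyperplane has no interior points. -/
theorem exists_mem_lorentz_ne_zero (he : lorentz e e = 1) {U : Set (HyperbolicSpace n)}
    (hU : IsOpen U) (hne : U.Nonempty) : ∃ y ∈ U, lorentz y.vec e ≠ 0 := by
  obtain ⟨y, hy⟩ := hne
  by_cases h : lorentz y.vec e = 0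
  · have h1 : normalPoint he y h 0 = y := by
      ext1
      simp [normalPoint]
    have h2 : ∀ᶠ s in nhds (0 : ℝ), normalPoint he y h s ∈ U :=
      (continuous_normalPoint he h).continuousAt.eventually_mem (hU.mem_nhds (by rwa [h1]))
    obtain ⟨s, hs, hs0⟩ := ((h2.filter_mono nhdsWithin_le_nhds).and
      (self_mem_nhdsWithin : {0}ᶜ ∈ nhdsWithin (0 : ℝ) {0}ᶜ)).exists
    exact ⟨_, hs, by rwa [lorentz_normalPoint, Ne, Real.sinh_eq_zero]⟩
  · exact ⟨y, hy, h⟩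

/-- Going from a point of a bounded set away from the hyperplane along the normal line, one
leaves the set through its frontier. -/
theorem exists_mem_frontier_proj_eq {R : Set (HyperbolicSpace n)} (hR : Bornology.IsBounded R)
    {y : HyperbolicSpace n} (hy : y ∈ R) (hye : lorentz y.vec e ≠ 0) :
    ∃ z ∈ frontier R, lorentz z.vec e ≠ 0 ∧ proj he z = proj he y := by
  set p := proj he y
  have hp : lorentz p.vec e = 0 := lorentz_proj he y
  set a := Real.arsinh (lorentz y.vec e) with ha
  have ha0 : a ≠ 0 := by rwa [ha, Ne, Real.arsinh_eq_zero_iff]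
  have hya : normalPoint he p hp a = y := normalPoint_proj he y
  -- Scaling by `a` puts `y` at `t = 1` whatever the side of the hyperplane; the ray `t ≥ 1` never
  -- returns to the hyperplane.
  set γ : ℝ → HyperbolicSpace n := fun t => normalPoint he p hp (t * a) with hγ
  have hγc : Continuous γ := (continuous_normalPoint he hp).comp (continuous_mul_const a)
  obtain ⟨C, hC⟩ := (Metric.isBounded_iff_subset_closedBall p).1 hR
  have hT : (γ '' Set.Ici 1 ∩ frontier R).Nonempty := by
    refine IsPreconnected.inter_frontier_nonempty (isPreconnected_Ici.image _ hγc.continuousOn)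
      ⟨y, ⟨1, le_refl (1 : ℝ), by simpa [hγ] using hya⟩, hy⟩ ?_
    -- This point is at distance `|a| + |C| + 1 > C` from `p`.
    refine ⟨γ (1 + (|C| + 1) / |a|), ⟨_, ?_, rfl⟩, fun h => ?_⟩
    · exact (le_add_iff_nonneg_right (1 : ℝ)).2 (by positivity : 0 ≤ (|C| + 1) / |a|)
    · have h1 := Metric.mem_closedBall.1 (hC h)
      rw [hγ, dist_normalPoint, abs_mul, abs_of_nonneg (by positivity), add_mul,
        div_mul_cancel₀ _ (abs_ne_zero.2 ha0)] at h1
      linarith [le_abs_self C, abs_nonneg a]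
  obtain ⟨_, ⟨t, ht, rfl⟩, hz⟩ := hT
  refine ⟨_, hz, ?_, proj_normalPoint he hp _⟩
  rw [lorentz_normalPoint, Ne, Real.sinh_eq_zero]
  exact mul_ne_zero (zero_lt_one.trans_le ht).ne' ha0

end Projection

/-! ### The Klein chart: hyperbolic hulls become Euclidean ones. -/

/-- The projective (Klein) model. -/
noncomputable def klein (x : HyperbolicSpace n) : EuclideanSpace ℝ (Fin n) := x.vec.1⁻¹ • x.vec.2

theorem time_smul_klein (x : HyperbolicSpace n) : x.vec.1 • klein x = x.vec.2 := by
  rw [klein, smul_smul, mul_inv_cancel₀ x.time_pos.ne', one_smul]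

theorem norm_klein_sq (x : HyperbolicSpace n) : ‖klein x‖ ^ 2 = 1 - (x.vec.1⁻¹) ^ 2 := by
  have := x.time_pos
  rw [klein, norm_smul, mul_pow, norm_sq_space, Real.norm_of_nonneg (by positivity)]
  field_simp

theorem norm_klein_lt_one (x : HyperbolicSpace n) : ‖klein x‖ < 1 := by
  have h : 0 < (x.vec.1⁻¹) ^ 2 := pow_pos (inv_pos.2 x.time_pos) 2
  have h1 := norm_klein_sq x
  exact lt_of_pow_lt_pow_left₀ 2 zero_le_one (by linarith)

/-- With `a = 1/x₀` and `b = 1/y₀`, the left side equals `2ab (cosh d - 1) - (a - b)²`, and `ab ≤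
1`. -/
theorem norm_klein_sub_sq_le (x y : HyperbolicSpace n) :
    ‖klein x - klein y‖ ^ 2 ≤ 2 * (Real.cosh (dist x y) - 1) := by
  have hx : 1 ≤ x.vec.1 := cosh_dist_origin x ▸ Real.one_le_cosh _
  have hy : 1 ≤ y.vec.1 := cosh_dist_origin y ▸ Real.one_le_cosh _
  have hx1 := inv_le_one_of_one_le₀ hx
  have hy1 := inv_le_one_of_one_le₀ hy
  have hx0 : 0 < x.vec.1⁻¹ := inv_pos.2 x.time_pos
  have hy0 : 0 < y.vec.1⁻¹ := inv_pos.2 y.time_pos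
  have h : inner ℝ (klein x) (klein y) = 1 - x.vec.1⁻¹ * y.vec.1⁻¹ * Real.cosh (dist x y) := by
    have := x.time_pos.ne'
    have := y.time_pos.ne'
    rw [cosh_dist, lorentz, klein, klein, real_inner_smul_left, real_inner_smul_right]
    field_simp
    ring
  rw [norm_sub_sq_real, norm_klein_sq, norm_klein_sq, h]
  nlinarith [sq_nonneg (x.vec.1⁻¹ - y.vec.1⁻¹), Real.one_le_cosh (dist x y),
    mul_nonneg (sub_nonneg.2 (mul_le_one₀ hx1 hy0.le hy1))
      (sub_nonneg.2 (Real.one_le_cosh (dist x y)))]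

theorem lipschitzOnWith_klein (x : HyperbolicSpace n) :
    LipschitzOnWith 2 (klein : HyperbolicSpace n → _) (Metric.ball x (1 / 2)) := by
  refine LipschitzOnWith.of_dist_le_mul fun y hy z hz => ?_
  rw [Metric.mem_ball] at hy hz
  have hd : dist y z ≤ 1 := by linarith [dist_triangle_right y z x]
  have hd0 : 0 ≤ dist y z := dist_nonneg
  have hd1 : dist y z ^ 2 ≤ 1 := pow_le_one₀ hd0 hd
  have h1 := norm_klein_sub_sq_le y z
  have h2 := Real.cosh_sub_one_le (t := dist y z) (by linarith)
  rw [dist_eq_norm, NNReal.coe_ofNat]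
  exact le_of_sq_le_sq (by nlinarith) (by positivity)

/-- The inverse of the chart `klein`. -/
noncomputable def kleinInv (u : Metric.ball (0 : EuclideanSpace ℝ (Fin n)) 1) :
    HyperbolicSpace n where
  vec := (√(1 - ‖u.1‖ ^ 2))⁻¹ • ((1 : ℝ), u.1)
  lorentz_self := by
    have hu : ‖u.1‖ < 1 := mem_ball_zero_iff.1 u.2
    have h0 : 0 < 1 - ‖u.1‖ ^ 2 := by nlinarith [norm_nonneg u.1]
    have h1 := Real.sqrt_pos.2 h0
    have h2 := Real.sq_sqrt h0.le
    rw [lorentz_smul_left, lorentz_smul_right, lorentz, real_inner_self_eq_norm_sq]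
    field_simp
    linarith
  time_pos := by
    have hu : ‖u.1‖ < 1 := mem_ball_zero_iff.1 u.2
    have h0 : 0 < 1 - ‖u.1‖ ^ 2 := by nlinarith [norm_nonneg u.1]
    have h1 := Real.sqrt_pos.2 h0
    simpa using h1

theorem continuous_kleinInv : Continuous (kleinInv (n := n)) := by
  refine continuous_of_continuous_vec ?_
  simp only [kleinInv]
  have h1 : Continuous fun u : Metric.ball (0 : EuclideanSpace ℝ (Fin n)) 1 =>
      √(1 - ‖u.1‖ ^ 2) := by fun_prop
  have h2 : Continuous fun u : Metric.ball (0 : EuclideanSpace ℝ (Fin n)) 1 =>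
      ((1 : ℝ), u.1) := by fun_prop
  refine (h1.inv₀ fun u => ?_).smul h2
  have hu : ‖u.1‖ < 1 := mem_ball_zero_iff.1 u.2
  exact (Real.sqrt_pos.2 (by nlinarith [norm_nonneg u.1])).ne'

theorem klein_kleinInv (u : Metric.ball (0 : EuclideanSpace ℝ (Fin n)) 1) :
    klein (kleinInv u) = u := by
  have h := (kleinInv u).time_pos.ne'
  rw [klein, inv_smul_eq_iff₀ h]
  simp [kleinInv]

theorem klein_injective : Function.Injective (klein (n := n)) := by
  intro x y h
  have h1 : x.vec.1 = y.vec.1 := by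
    have h2 := norm_klein_sq x
    rw [h, norm_klein_sq y] at h2
    exact inv_injective (((pow_left_inj₀ (inv_pos.2 x.time_pos).le (inv_pos.2 y.time_pos).le
      two_ne_zero)).1 (by linarith))
  ext1
  refine Prod.ext h1 ?_
  rw [← time_smul_klein, ← time_smul_klein, h, h1]

theorem kleinInv_klein (x : HyperbolicSpace n) :
    kleinInv ⟨klein x, mem_ball_zero_iff.2 (norm_klein_lt_one x)⟩ = x :=
  klein_injective (klein_kleinInv _)

theorem vec_eq_smul (x : HyperbolicSpace n) : x.vec = x.vec.1 • ((1 : ℝ), klein x) := by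
  refine Prod.ext (by simp) ?_
  simp [time_smul_klein]

/-- A cone coefficient `c v` corresponds to the convex weight `c v * v₀ / x₀`; the time coordinate
of the cone relation says that these weights sum to one. -/
theorem mem_hull_iff (V : Finset (HyperbolicSpace n)) (x : HyperbolicSpace n) :
    x ∈ hull V ↔ klein x ∈ convexHull ℝ (klein '' (V : Set (HyperbolicSpace n))) := by
  classical
  constructor
  · rintro ⟨c, hc, hx⟩
    have h1 : x.vec.1 = ∑ v ∈ V, c v * v.vec.1 := by rw [hx]; simp [Prod.fst_sum]
    have h2 : x.vec.2 = ∑ v ∈ V, c v • v.vec.2 := by rw [hx]; simp [Prod.snd_sum]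
    have hx0 := x.time_pos
    have h3 : klein x = ∑ v ∈ V, (x.vec.1⁻¹ * (c v * v.vec.1)) • klein v := by
      rw [klein, h2, Finset.smul_sum]
      refine Finset.sum_congr rfl fun v _ => ?_
      rw [← time_smul_klein v, smul_smul, smul_smul, mul_assoc]
    rw [h3]
    refine (convex_convexHull ℝ _).sum_mem (fun v hv => ?_) ?_ fun v hv =>
      subset_convexHull ℝ _ ⟨v, hv, rfl⟩
    · have := v.time_pos
      have := hc v hv
      positivity
    · rw [← Finset.mul_sum, ← h1, inv_mul_cancel₀ hx0.ne']
  · intro hx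
    rw [← Finset.coe_image, Finset.mem_convexHull'] at hx
    obtain ⟨w, hw0, hw1, hwx⟩ := hx
    rw [Finset.sum_image klein_injective.injOn] at hw1 hwx
    have hx0 := x.time_pos
    refine ⟨fun v => x.vec.1 * w (klein v) * v.vec.1⁻¹, fun v hv => ?_, ?_⟩
    · have := v.time_pos
      have := hw0 _ (Finset.mem_image_of_mem klein hv)
      positivity
    · have h1 : ∀ v ∈ V, (x.vec.1 * w (klein v) * v.vec.1⁻¹) • v.vec =
          x.vec.1 • (w (klein v) • ((1 : ℝ), klein v)) := by
        intro v _
        nth_rw 2 [vec_eq_smul v]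
        rw [smul_smul, smul_smul, inv_mul_cancel_right₀ v.time_pos.ne']
      rw [Finset.sum_congr rfl h1, ← Finset.smul_sum]
      refine (vec_eq_smul x).trans (congrArg (x.vec.1 • ·) ?_)
      refine Prod.ext ?_ ?_
      · simp [Prod.fst_sum, hw1]
      · simp [Prod.snd_sum, hwx]

theorem convexHull_klein_subset (s : Set (HyperbolicSpace n)) :
    convexHull ℝ (klein '' s) ⊆ Metric.ball 0 1 :=
  convexHull_min (by rintro _ ⟨v, -, rfl⟩; exact mem_ball_zero_iff.2 (norm_klein_lt_one v))
    (convex_ball (0 : EuclideanSpace ℝ (Fin n)) 1)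

theorem isCompact_hull (V : Finset (HyperbolicSpace n)) : IsCompact (hull V) := by
  have hC : IsCompact (convexHull ℝ (klein '' (V : Set (HyperbolicSpace n)))) :=
    (V.finite_toSet.image klein).isCompact_convexHull ℝ
  have h1 : IsCompact ((↑) ⁻¹' convexHull ℝ (klein '' (V : Set (HyperbolicSpace n))) :
      Set (Metric.ball (0 : EuclideanSpace ℝ (Fin n)) 1)) := by
    rw [Subtype.isCompact_iff, Subtype.image_preimage_coe,
      Set.inter_eq_right.2 (convexHull_klein_subset _)]
    exact hC
  convert h1.image continuous_kleinInv using 1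
  ext x
  rw [mem_hull_iff]
  constructor
  · exact fun h => ⟨_, h, kleinInv_klein x⟩
  · rintro ⟨u, hu, rfl⟩
    rwa [klein_kleinInv]

/-! ### Positive measure of polyhedral sets near their points. -/

/-- Each `v.vec` is a multiple of `(1, klein v₀) + (0, klein v - klein v₀)`, so the span needs one
dimension beyond the affine directions in the chart. -/
theorem finrank_span_vec_le {V : Set (HyperbolicSpace n)} {v₀ : HyperbolicSpace n} (h₀ : v₀ ∈ V) :
    Module.finrank ℝ (Submodule.span ℝ (vec '' V)) ≤
      Module.finrank ℝ (vectorSpan ℝ (klein '' V)) + 1 := by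
  have hle : Submodule.span ℝ (vec '' V) ≤ Submodule.span ℝ {((1 : ℝ), klein v₀)} ⊔
      (vectorSpan ℝ (klein '' V)).map (LinearMap.inr ℝ ℝ (EuclideanSpace ℝ (Fin n))) := by
    refine Submodule.span_le.2 ?_
    rintro _ ⟨v, hv, rfl⟩
    rw [SetLike.mem_coe, vec_eq_smul]
    refine Submodule.smul_mem _ _ (Submodule.mem_sup.2 ⟨_, Submodule.mem_span_singleton_self _, _,
      Submodule.mem_map_of_mem (vsub_mem_vectorSpan ℝ (Set.mem_image_of_mem klein hv)
        (Set.mem_image_of_mem klein h₀)), ?_⟩)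
    simp
  refine (Submodule.finrank_mono hle).trans
    ((Submodule.finrank_add_le_finrank_add_finrank _ _).trans ?_)
  rw [add_comm]
  exact add_le_add (Submodule.finrank_map_le _ _) (finrank_span_singleton (by simp)).le

/-- A subspace of dimension at least `d` can be mapped onto `ℝ^d`. -/
theorem _root_.Submodule.exists_map_eq_top {E : Type*} [AddCommGroup E] [Module ℝ E]
    [FiniteDimensional ℝ E] (D : Submodule ℝ E) {d : ℕ} (hd : d ≤ Module.finrank ℝ D) :
    ∃ L : E →ₗ[ℝ] (Fin d → ℝ), D.map L = ⊤ := by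
  have e := (Module.finBasis ℝ D).equivFun
  obtain ⟨L, hL⟩ := LinearMap.exists_extend
    ((LinearMap.funLeft ℝ ℝ (Fin.castLE hd)).comp (e : D →ₗ[ℝ] _))
  refine ⟨L, ?_⟩
  have h1 : D.map L = LinearMap.range (L.comp D.subtype) := by
    rw [LinearMap.range_comp, Submodule.range_subtype]
  rw [h1, hL, LinearMap.range_eq_top]
  exact (LinearMap.funLeft_surjective_of_injective ℝ ℝ _ (Fin.castLE_injective hd)).comp
    e.surjective

/-- A linear map that sends the directions of the hull onto `ℝ^d` makes its image a convex set with
full affine span, hence with nonempty interior. -/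
theorem exists_volume_image_convexHull_pos {d : ℕ} {V : Finset (HyperbolicSpace n)}
    (hV : Module.finrank ℝ (Submodule.span ℝ (vec '' (V : Set (HyperbolicSpace n)))) = d + 1) :
    ∃ L : EuclideanSpace ℝ (Fin n) →ₗ[ℝ] (Fin d → ℝ),
      0 < volume (L '' convexHull ℝ (klein '' (V : Set (HyperbolicSpace n)))) := by
  obtain ⟨v₀, h₀⟩ : (V : Set (HyperbolicSpace n)).Nonempty := by
    by_contra h
    rw [Set.not_nonempty_iff_eq_empty] at h
    rw [h, Set.image_empty, Submodule.span_empty, finrank_bot] at hV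
    omega
  have hd := finrank_span_vec_le h₀
  rw [hV] at hd
  obtain ⟨L, hL⟩ := Submodule.exists_map_eq_top (d := d)
    (vectorSpan ℝ (klein '' (V : Set (HyperbolicSpace n)))) (by omega)
  refine ⟨L, ?_⟩
  set C := convexHull ℝ (klein '' (V : Set (HyperbolicSpace n))) with hC
  have hconv : Convex ℝ (L '' C) := (convex_convexHull ℝ _).linear_image L
  have htop : affineSpan ℝ (L '' C) = ⊤ := by
    refine (AffineSubspace.affineSpan_eq_top_iff_vectorSpan_eq_top_of_nonempty ℝ _ _
      ⟨_, Set.mem_image_of_mem L (subset_convexHull ℝ _ (Set.mem_image_of_mem klein h₀))⟩).2 ?_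
    have h1 : vectorSpan ℝ (L '' C) = (vectorSpan ℝ C).map L := by
      simpa using (AffineMap.map_vectorSpan (f := L.toAffineMap) (s := C)).symm
    have h2 : vectorSpan ℝ C = vectorSpan ℝ (klein '' (V : Set (HyperbolicSpace n))) := by
      rw [← direction_affineSpan, hC, affineSpan_convexHull, direction_affineSpan]
    rw [h1, h2, hL]
  exact Measure.measure_pos_of_nonempty_interior _
    (hconv.interior_nonempty_iff_affineSpan_eq_top.2 htop)

/-- In the chart, convexity lets the hull be shrunk towards `klein x` into any neighbourhood while
staying in itself. The image of the shrunken copy in `ℝ^d` has positive volume, and `L ∘ klein` is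
Lipschitz near `x`, so its source has positive Hausdorff measure. -/
theorem hausdorffMeasure_hull_inter_pos {d : ℕ} {V : Finset (HyperbolicSpace n)}
    (hV : Module.finrank ℝ (Submodule.span ℝ (vec '' (V : Set (HyperbolicSpace n)))) = d + 1)
    {x : HyperbolicSpace n} (hx : x ∈ hull V) {U : Set (HyperbolicSpace n)} (hU : U ∈ nhds x) :
    0 < Measure.hausdorffMeasure (d : ℝ) (hull V ∩ U) := by
  set C := convexHull ℝ (klein '' (V : Set (HyperbolicSpace n))) with hC
  have hxC : klein x ∈ C := (mem_hull_iff V x).1 hx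
  obtain ⟨L, hLC⟩ := exists_volume_image_convexHull_pos hV
  rw [← hC] at hLC
  set x' : Metric.ball (0 : EuclideanSpace ℝ (Fin n)) 1 :=
    ⟨klein x, mem_ball_zero_iff.2 (norm_klein_lt_one x)⟩
  have hx' : kleinInv x' = x := kleinInv_klein x
  set A := hull V ∩ U ∩ Metric.ball x (1 / 2) with hA
  have hnhds : kleinInv ⁻¹' (U ∩ Metric.ball x (1 / 2)) ∈ nhds x' := by
    refine continuous_kleinInv.continuousAt.preimage_mem_nhds ?_
    rw [hx']
    exact Filter.inter_mem hU (Metric.ball_mem_nhds x (by norm_num))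
  obtain ⟨δ, hδ, hball⟩ := Metric.mem_nhds_iff.1 hnhds
  -- Points of the unit ball are less than `2` apart, so shrinking by `s ≤ δ / 4` brings the hull
  -- within `δ` of `klein x`.
  set s : ℝ := min 1 (δ / 4) with hs
  have hs0 : 0 < s := by positivity
  have hs1 : s ≤ 1 := min_le_left _ _
  have hsδ : s ≤ δ / 4 := min_le_right _ _
  have hsub : AffineMap.homothety (L (klein x)) s '' (L '' C) ⊆ (L ∘ klein) '' A := by
    rintro _ ⟨_, ⟨w, hw, rfl⟩, rfl⟩
    have hmem : AffineMap.lineMap (klein x) w s ∈ C :=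
      (convex_convexHull ℝ _).lineMap_mem hxC hw ⟨hs0.le, hs1⟩
    set u : Metric.ball (0 : EuclideanSpace ℝ (Fin n)) 1 :=
      ⟨AffineMap.lineMap (klein x) w s, convexHull_klein_subset _ hmem⟩ with hu
    have hdist : dist u x' < δ := by
      rw [Subtype.dist_eq]
      change dist (AffineMap.lineMap (klein x) w s) (klein x) < δ
      rw [dist_lineMap_left, Real.norm_of_nonneg hs0.le]
      have h1 := mem_ball_zero_iff.1 (convexHull_klein_subset _ hw)
      have h2 : dist (klein x) w < 2 := by
        rw [dist_eq_norm]
        linarith [norm_sub_le (klein x) w, norm_klein_lt_one x]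
      nlinarith [dist_nonneg (x := klein x) (y := w)]
    have h3 := hball (Metric.mem_ball.2 hdist)
    refine ⟨kleinInv u, ⟨⟨(mem_hull_iff V _).2 ?_, h3.1⟩, h3.2⟩, ?_⟩
    · rwa [klein_kleinInv]
    · rw [Function.comp_apply, klein_kleinInv, hu]
      simp [AffineMap.lineMap_apply, AffineMap.homothety_apply]
  have hpos : 0 < (volume ((L ∘ klein) '' A) : ENNReal) := by
    refine lt_of_lt_of_le ?_ (measure_mono hsub)
    rw [Measure.addHaar_image_homothety]
    exact ENNReal.mul_pos (by simpa using fun h => absurd h hs0.ne') hLC.ne'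
  have hlip := ((LinearMap.toContinuousLinearMap L).lipschitz.comp_lipschitzOnWith
    ((lipschitzOnWith_klein x).mono (Set.inter_subset_right : A ⊆ _)))
  have hle := hlip.hausdorffMeasure_image_le (d := (d : ℝ)) (Nat.cast_nonneg d)
  -- The target carries the sup metric, for which Hausdorff measure is exactly Lebesgue measure.
  have hvol : (Measure.hausdorffMeasure (d : ℝ) : Measure (Fin d → ℝ)) = volume := by
    rw [← hausdorffMeasure_pi_real, Fintype.card_fin]
  rw [hvol] at hle
  have hA0 : Measure.hausdorffMeasure (d : ℝ) A ≠ 0 := by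
    intro h0
    rw [h0, mul_zero] at hle
    exact (hpos.trans_le hle).false
  exact (pos_iff_ne_zero.2 hA0).trans_le (measure_mono Set.inter_subset_left)

theorem IsPolyhedral.isCompact {d : ℕ} {A : Set (HyperbolicSpace n)} (hA : IsPolyhedral d A) :
    IsCompact A := by
  obtain ⟨C, hC, hK, rfl⟩ := hA
  refine hC.isCompact_sUnion fun K hKC => ?_
  obtain ⟨V, -, rfl⟩ := hK K hKC
  exact isCompact_hull V

/-- Polyhedral sets have positive measure near each of their points. -/
theorem IsPolyhedral.hausdorffMeasure_inter_pos {d : ℕ} {A : Set (HyperbolicSpace n)}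
    (hA : IsPolyhedral d A) {x : HyperbolicSpace n} (hx : x ∈ A) {U : Set (HyperbolicSpace n)}
    (hU : U ∈ nhds x) : 0 < Measure.hausdorffMeasure (d : ℝ) (A ∩ U) := by
  obtain ⟨C, hC, hK, rfl⟩ := hA
  obtain ⟨K, hKC, hxK⟩ := hx
  obtain ⟨V, hV, rfl⟩ := hK K hKC
  exact (hausdorffMeasure_hull_inter_pos hV hxK hU).trans_le
    (measure_mono (Set.inter_subset_inter_left _ (Set.subset_sUnion_of_mem hKC)))

/-! ### Loss of measure under projection. -/

theorem IsHyperplane.exists_unit_normal {h : Set (HyperbolicSpace n)} (hh : IsHyperplane h) :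
    ∃ e : ℝ × EuclideanSpace ℝ (Fin n), lorentz e e = 1 ∧ h = {x | lorentz x.vec e = 0} := by
  obtain ⟨ν, hν, rfl⟩ := hh
  have h0 := Real.sqrt_pos.2 hν
  refine ⟨(√(lorentz ν ν))⁻¹ • ν, ?_, ?_⟩
  · rw [lorentz_smul_left, lorentz_smul_right]
    field_simp
    rw [Real.sq_sqrt hν.le]
  · ext x
    simp [lorentz_smul_right, h0.ne']

section Projection

variable {e : ℝ × EuclideanSpace ℝ (Fin n)} (he : lorentz e e = 1)

theorem hausdorffMeasure_image_proj_le (d : ℕ) (A : Set (HyperbolicSpace n)) :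
    Measure.hausdorffMeasure (d : ℝ) (proj he '' A) ≤ Measure.hausdorffMeasure (d : ℝ) A := by
  simpa using (lipschitzWith_proj he).hausdorffMeasure_image_le (d := (d : ℝ)) d.cast_nonneg A

/-- A polyhedral set that leaves the hyperplane loses measure under projection. -/
theorem IsPolyhedral.hausdorffMeasure_image_proj_lt {d : ℕ} (hd : d ≠ 0)
    {A : Set (HyperbolicSpace n)} (hA : IsPolyhedral d A)
    (hfin : Measure.hausdorffMeasure (d : ℝ) A ≠ ⊤)
    {x : HyperbolicSpace n} (hx : x ∈ A) (hxe : lorentz x.vec e ≠ 0) :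
    Measure.hausdorffMeasure (d : ℝ) (proj he '' A) < Measure.hausdorffMeasure (d : ℝ) A := by
  set μ : Measure (HyperbolicSpace n) := Measure.hausdorffMeasure (d : ℝ)
  obtain ⟨r, hr, K, hK, hlip⟩ := exists_lipschitzOnWith_proj he hxe
  set B := Metric.closedBall x r
  have hB0 : μ (A ∩ B) ≠ 0 :=
    (hA.hausdorffMeasure_inter_pos hx (Metric.closedBall_mem_nhds x hr)).ne'
  have hBtop : μ (A ∩ B) ≠ ⊤ := measure_ne_top_of_subset Set.inter_subset_left hfin
  have hDtop : μ (A \ B) ≠ ⊤ := measure_ne_top_of_subset Set.sdiff_subset hfin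
  have h1 : Measure.hausdorffMeasure (d : ℝ) (proj he '' (A ∩ B)) < μ (A ∩ B) := by
    refine ((hlip.mono Set.inter_subset_right).hausdorffMeasure_image_le
      (d := (d : ℝ)) d.cast_nonneg).trans_lt ?_
    -- Positive dimension is essential here: in dimension `0` a contraction loses no measure.
    have hKd : (K : ENNReal) ^ (d : ℝ) < 1 := by
      rw [ENNReal.rpow_natCast]
      exact pow_lt_one₀ zero_le (by exact_mod_cast hK) hd
    calc (K : ENNReal) ^ (d : ℝ) * μ (A ∩ B) < 1 * μ (A ∩ B) :=
          (ENNReal.mul_lt_mul_iff_left hB0 hBtop).2 hKd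
      _ = μ (A ∩ B) := one_mul _
  calc μ (proj he '' A) ≤ μ (proj he '' (A ∩ B)) + μ (proj he '' (A \ B)) := by
        rw [← Set.inter_union_sdiff A B, Set.image_union]
        simpa [Set.inter_union_sdiff] using measure_union_le (μ := μ) _ _
    _ < μ (A ∩ B) + μ (A \ B) := by
        have h2 := hausdorffMeasure_image_proj_le he d (A \ B)
        exact ENNReal.add_lt_add_of_lt_of_le (ne_top_of_le_ne_top hDtop h2) h1 h2
    _ = μ A := measure_inter_add_sdiff A Metric.isClosed_closedBall.measurableSet

end Projection

/-- Deleting `A i ∩ A j` from `A i` leaves the union unchanged, since `A j` still covers it; so the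
overlap is an excess of the sum over the measure of the union. -/
theorem _root_.MeasureTheory.measure_inter_eq_zero_of_sum_le {α ι : Type*} [MeasurableSpace α]
    [DecidableEq ι] {μ : Measure α} {s : Finset ι} {A : ι → Set α}
    (hm : ∀ i ∈ s, MeasurableSet (A i)) (hfin : ∀ i ∈ s, μ (A i) ≠ ⊤)
    (h : ∑ i ∈ s, μ (A i) ≤ μ (⋃ i ∈ s, A i)) {i j : ι} (hi : i ∈ s) (hj : j ∈ s) (hij : i ≠ j) :
    μ (A i ∩ A j) = 0 := by
  have h1 : (⋃ k ∈ s, A k) ⊆ A i \ A j ∪ ⋃ k ∈ s.erase i, A k := by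
    refine Set.iUnion₂_subset fun k hk x hx => ?_
    by_cases hxj : x ∈ A j
    · exact Or.inr (Set.mem_biUnion (Finset.mem_erase.2 ⟨hij.symm, hj⟩) hxj)
    · by_cases hki : k = i
      · exact Or.inl ⟨hki ▸ hx, hxj⟩
      · exact Or.inr (Set.mem_biUnion (Finset.mem_erase.2 ⟨hki, hk⟩) hx)
  have h2 : μ (⋃ k ∈ s, A k) ≤ μ (A i \ A j) + ∑ k ∈ s.erase i, μ (A k) :=
    (measure_mono h1).trans ((measure_union_le _ _).trans
      (add_le_add_right (measure_biUnion_finset_le _ _) _))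
  have hne : ∑ k ∈ s.erase i, μ (A k) ≠ ⊤ :=
    ENNReal.sum_ne_top.2 fun k hk => hfin k (Finset.mem_of_mem_erase hk)
  have hne' : μ (A i \ A j) ≠ ⊤ := measure_ne_top_of_subset Set.sdiff_subset (hfin i hi)
  have h3 := h.trans h2
  rw [← Finset.add_sum_erase s _ hi, ENNReal.add_le_add_iff_right hne,
    ← measure_inter_add_sdiff (A i) (hm j hj)] at h3
  have h4 : μ (A i ∩ A j) + μ (A i \ A j) ≤ 0 + μ (A i \ A j) := by rwa [zero_add]
  exact le_zero_iff.1 ((ENNReal.add_le_add_iff_right hne').1 h4)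

/-! ### Facets of a polytope: covering, inequality and equality. -/

namespace Polytope

variable {m : ℕ} (P : Polytope n m) {k : Fin m} {e : ℝ × EuclideanSpace ℝ (Fin n)}

/-- Over a point of the solid part off the hyperplane of a facet there is another facet. -/
theorem exists_facet_proj_eq (he : lorentz e e = 1)
    (hk : P.facet k ⊆ {x | lorentz x.vec e = 0}) {y : HyperbolicSpace n}
    (hy : y ∈ closure (interior P.carrier)) (hye : lorentz y.vec e ≠ 0) :
    ∃ i, i ≠ k ∧ ∃ z ∈ P.facet i, lorentz z.vec e ≠ 0 ∧ proj he z = proj he y := by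
  obtain ⟨z, hz, hze, hzy⟩ :=
    exists_mem_frontier_proj_eq he P.solid_polyhedral.isCompact.isBounded hy hye
  obtain ⟨i, hi⟩ := Set.mem_iUnion.1 (P.frontier_subset hz)
  exact ⟨i, fun hik => hze (hk (hik ▸ hi)), z, hi, hze, hzy⟩

/-- The projections of the other facets cover a facet. -/
theorem facet_subset_biUnion_image_proj (he : lorentz e e = 1)
    (hk : P.facet k ⊆ {x | lorentz x.vec e = 0}) :
    P.facet k ⊆ ⋃ i ∈ Finset.univ.erase k, proj he '' P.facet i := by
  intro x hx
  by_contra hxU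
  set T := ⋃ i ∈ Finset.univ.erase k, proj he '' P.facet i with hT
  have hTc : IsClosed T := (Finset.isCompact_biUnion _ fun i _ =>
    ((P.facet_polyhedral i).isCompact.image (lipschitzWith_proj he).continuous)).isClosed
  -- The open cylinder of normal lines over the complement of `T`; no facet other than `F_k` meets
  -- it.
  set C := proj he ⁻¹' Tᶜ with hC
  have hCo : IsOpen C := hTc.isOpen_compl.preimage (lipschitzWith_proj he).continuous
  have hxC : x ∈ C := by
    change proj he x ∉ T
    rwa [proj_eq_self he (hk hx)]
  have hoff : ∀ y ∈ C, ∀ i, y ∈ P.facet i → i = k := fun y hy i hi => by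
    by_contra hik
    exact hy (Set.mem_biUnion (Finset.mem_coe.2 (Finset.mem_erase.2 ⟨hik, Finset.mem_univ i⟩))
      (Set.mem_image_of_mem _ hi))
  -- Parity holds only almost everywhere and may fail at `x` itself; positive measure supplies a
  -- nearby point `z` of the facet where it holds.
  have hpos := (P.facet_polyhedral k).hausdorffMeasure_inter_pos hx (hCo.mem_nhds hxC)
  obtain ⟨z, ⟨hzk, hzC⟩, hz⟩ : ∃ z ∈ P.facet k ∩ C,
      (Odd {i | z ∈ P.facet i}.ncard ↔ z ∈ frontier (closure (interior P.carrier))) := by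
    by_contra h
    exact hpos.ne' (measure_mono_null (fun z hz hz' => h ⟨z, hz, hz'⟩)
      (ae_iff.1 P.facet_parity))
  have hone : {i | z ∈ P.facet i} = {k} :=
    Set.eq_singleton_iff_unique_mem.2 ⟨hzk, fun i hi => hoff z hzC i hi⟩
  rw [hone, Set.ncard_singleton] at hz
  have hzR : z ∈ closure (interior P.carrier) :=
    isClosed_closure.frontier_subset (hz.1 odd_one)
  obtain ⟨y, ⟨hyC, hyI⟩, hye⟩ := exists_mem_lorentz_ne_zero he (hCo.inter isOpen_interior)
    (mem_closure_iff.1 hzR C hCo hzC)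
  obtain ⟨i, hik, w, hw, -, hwy⟩ := P.exists_facet_proj_eq he hk (subset_closure hyI) hye
  refine hik (hoff w ?_ i hw)
  change proj he w ∈ Tᶜ
  rwa [hwy]

/-- If all facets lie in one hyperplane, then the polytope is the union of its facets. -/
theorem carrier_eq_iUnion_facet (he : lorentz e e = 1)
    (h : ∀ i, P.facet i ⊆ {x | lorentz x.vec e = 0}) (k : Fin m) : P.carrier = ⋃ i, P.facet i := by
  have h0 : interior P.carrier = ∅ := by
    by_contra hne
    obtain ⟨y, hy, hye⟩ := exists_mem_lorentz_ne_zero he isOpen_interior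
      (Set.nonempty_iff_ne_empty.2 hne)
    obtain ⟨i, -, z, hz, hze, -⟩ := P.exists_facet_proj_eq he (h k) (subset_closure hy) hye
    exact hze (h i hz)
  rw [P.carrier_eq, h0, closure_empty, Set.empty_union]

theorem hausdorffMeasure_facet_le (k : Fin m) :
    Measure.hausdorffMeasure ((n - 1 : ℕ) : ℝ) (P.facet k) ≤
      ∑ i ∈ Finset.univ.erase k, Measure.hausdorffMeasure ((n - 1 : ℕ) : ℝ) (P.facet i) := by
  obtain ⟨h, hh, hk⟩ := P.facet_in_hyperplane k
  obtain ⟨e, he, rfl⟩ := hh.exists_unit_normal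
  exact (measure_mono (P.facet_subset_biUnion_image_proj he hk)).trans
    ((measure_biUnion_finset_le _ _).trans
      (Finset.sum_le_sum fun i _ => hausdorffMeasure_image_proj_le he _ _))

theorem hVolume_eq_zero_iff {d : ℕ} {A : Set (HyperbolicSpace n)} :
    hVolume d A = 0 ↔ Measure.hausdorffMeasure (d : ℝ) A = 0 := by
  have h : volume (Metric.ball (0 : EuclideanSpace ℝ (Fin d)) (1 / 2)) ≠ 0 :=
    (Metric.measure_ball_pos _ _ (by norm_num)).ne'
  rw [hVolume, mul_eq_zero, or_iff_right h]

/-- The hypothesis forces equality throughout `μ(F_k) ≤ μ(⋃ proj F_i) ≤ ∑ μ(proj F_i) ≤ ∑ μ(F_i)`.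
Equality at the end puts all facets in the hyperplane; the projections then disappear, and equality
in the rest excludes excess and overlap. -/
theorem isDoublyCountedFacet_of_sum_le (hn : n - 1 ≠ 0)
    (hfin : ∀ i, Measure.hausdorffMeasure ((n - 1 : ℕ) : ℝ) (P.facet i) ≠ ⊤)
    (hsum : ∑ i ∈ Finset.univ.erase k, Measure.hausdorffMeasure ((n - 1 : ℕ) : ℝ) (P.facet i) ≤
      Measure.hausdorffMeasure ((n - 1 : ℕ) : ℝ) (P.facet k)) :
    P.IsDoublyCountedFacet k := by
  set μ : Measure (HyperbolicSpace n) := Measure.hausdorffMeasure ((n - 1 : ℕ) : ℝ) with hμ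
  obtain ⟨h, hh, hk⟩ := P.facet_in_hyperplane k
  obtain ⟨e, he, rfl⟩ := hh.exists_unit_normal
  have hcov := P.facet_subset_biUnion_image_proj he hk
  have hle : ∀ i, μ (proj he '' P.facet i) ≤ μ (P.facet i) := fun i =>
    hausdorffMeasure_image_proj_le he _ _
  have hplane : ∀ i, P.facet i ⊆ {x | lorentz x.vec e = 0} := by
    intro i x hx
    by_contra hxe
    have hik : i ∈ Finset.univ.erase k :=
      Finset.mem_erase.2 ⟨fun hik => hxe (hk (hik ▸ hx)), Finset.mem_univ i⟩
    have hlt := (P.facet_polyhedral i).hausdorffMeasure_image_proj_lt he hn (hfin i) hx hxe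
    have h1 : ∑ j ∈ Finset.univ.erase k, μ (proj he '' P.facet j) <
        ∑ j ∈ Finset.univ.erase k, μ (P.facet j) := by
      rw [← Finset.add_sum_erase _ _ hik,
        ← Finset.add_sum_erase _ (fun j => μ (P.facet j)) hik]
      refine ENNReal.add_lt_add_of_lt_of_le (ENNReal.sum_ne_top.2 fun j _ =>
        ne_top_of_le_ne_top (hfin j) (hle j)) hlt (Finset.sum_le_sum fun j _ => hle j)
    exact ((measure_mono hcov).trans (measure_biUnion_finset_le _ _)).not_gt (h1.trans_le hsum)
  have himage : ∀ i, proj he '' P.facet i = P.facet i := fun i => by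
    rw [Set.image_congr fun x hx => proj_eq_self he (hplane i hx), Set.image_id']
  simp only [himage] at hcov
  have hm : ∀ i, MeasurableSet (P.facet i) := fun i =>
    (P.facet_polyhedral i).isCompact.isClosed.measurableSet
  have hnull : μ ((⋃ i ∈ Finset.univ.erase k, P.facet i) \ P.facet k) = 0 := by
    rw [measure_sdiff hcov (hm k).nullMeasurableSet (hfin k)]
    exact tsub_eq_zero_of_le ((measure_biUnion_finset_le _ _).trans hsum)
  -- The excess over `F_k` is null, but a facet with a point outside the closed set `F_k` would have
  -- positive measure there.
  have hsub : ∀ i, P.facet i ⊆ P.facet k := by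
    intro i x hx
    by_contra hxk
    have hik : i ∈ Finset.univ.erase k :=
      Finset.mem_erase.2 ⟨fun hik => hxk (hik ▸ hx), Finset.mem_univ i⟩
    have hpos := (P.facet_polyhedral i).hausdorffMeasure_inter_pos hx
      ((P.facet_polyhedral k).isCompact.isClosed.isOpen_compl.mem_nhds hxk)
    have hincl : P.facet i ∩ (P.facet k)ᶜ ⊆
        (⋃ i ∈ Finset.univ.erase k, P.facet i) \ P.facet k :=
      fun y hy => ⟨Set.mem_biUnion (Finset.mem_coe.2 hik) hy.1, hy.2⟩
    exact hpos.ne' (measure_mono_null hincl hnull)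
  refine ⟨?_, ?_, fun i j hi hj hij => ?_⟩
  · rw [P.carrier_eq_iUnion_facet he hplane k]
    exact (Set.iUnion_subset hsub).antisymm (Set.subset_iUnion _ k)
  · refine (Set.iUnion₂_subset fun i _ => hsub i).antisymm (hcov.trans_eq ?_)
    simp
  · rw [hVolume_eq_zero_iff]
    exact measure_inter_eq_zero_of_sum_le (fun i _ => hm i) (fun i _ => hfin i)
      (hsum.trans (measure_mono hcov)) (by simpa using hi) (by simpa using hj) hij

theorem IsDoublyCountedFacet.hausdorffMeasure_facet_eq {P : Polytope n m}
    (h : P.IsDoublyCountedFacet k) :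
    Measure.hausdorffMeasure ((n - 1 : ℕ) : ℝ) (P.facet k) =
      ∑ i ∈ Finset.univ.erase k, Measure.hausdorffMeasure ((n - 1 : ℕ) : ℝ) (P.facet i) := by
  have h1 : P.facet k = ⋃ i ∈ Finset.univ.erase k, P.facet i := by
    rw [← h.2.1]
    simp
  rw [h1, measure_biUnion_finset₀]
  · intro i hi j hj hij
    exact hVolume_eq_zero_iff.1 (h.2.2 i j (by simpa using hi) (by simpa using hj) hij)
  · exact fun i _ => (P.facet_polyhedral i).isCompact.isClosed.measurableSet.nullMeasurableSet

end Polytope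

end HyperbolicSpace

theorem mainTheorem6 (n : ℕ) (hn : 2 ≤ n) (m : ℕ) (P : HyperbolicSpace.Polytope n (m + 1))
    (S : Fin (m + 1) → ℝ) (hS : ∀ i, P.facetArea i = ENNReal.ofReal (S i))
    (hmono : Monotone S) (hpos : ∀ i, 0 < S i) :
    S (Fin.last m) ≤ ∑ i : Fin m, S i.castSucc ∧
    (S (Fin.last m) = ∑ i : Fin m, S i.castSucc ↔ P.IsDoublyCountedFacet (Fin.last m)) := by
  -- The normalising factor of area is positive and finite, so it cancels and only Hausdorff
  -- measures need comparing.
  set c := volume (Metric.ball (0 : EuclideanSpace ℝ (Fin (n - 1))) (1 / 2)) with hc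
  set μ : Measure (HyperbolicSpace n) := Measure.hausdorffMeasure ((n - 1 : ℕ) : ℝ) with hμ
  have hc0 : c ≠ 0 := (Metric.measure_ball_pos _ _ (by norm_num)).ne'
  have hctop : c ≠ ⊤ := measure_ball_lt_top.ne
  have hS' : ∀ i, c * μ (P.facet i) = ENNReal.ofReal (S i) := hS
  have hfin : ∀ i, μ (P.facet i) ≠ ⊤ := fun i h => by
    have := hS' i
    rw [h, ENNReal.mul_top hc0] at this
    exact ENNReal.ofReal_ne_top this.symm
  have hsum : c * ∑ i ∈ Finset.univ.erase (Fin.last m), μ (P.facet i) =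
      ENNReal.ofReal (∑ i : Fin m, S i.castSucc) := by
    have herase : Finset.univ.erase (Fin.last m) = Finset.univ.map Fin.castSuccEmb := by
      ext i
      simp [Fin.exists_castSucc_eq]
    rw [herase, Finset.sum_map, Finset.mul_sum, ENNReal.ofReal_sum_of_nonneg fun i _ => (hpos _).le]
    exact Finset.sum_congr rfl fun i _ => hS' _
  have hsum0 : 0 ≤ ∑ i : Fin m, S i.castSucc := Finset.sum_nonneg fun i _ => (hpos _).le
  have hle := P.hausdorffMeasure_facet_le (Fin.last m)
  refine ⟨?_, fun h => ?_, fun h => ?_⟩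
  · rw [← ENNReal.ofReal_le_ofReal_iff hsum0, ← hS', ← hsum]
    exact mul_le_mul_right hle c
  · refine P.isDoublyCountedFacet_of_sum_le (by omega) hfin ?_
    rw [← ENNReal.mul_le_mul_iff_right hc0 hctop]
    exact (hsum.trans ((congrArg ENNReal.ofReal h.symm).trans (hS' _).symm)).le
  · rw [← ENNReal.ofReal_eq_ofReal_iff (hpos _).le hsum0, ← hS', ← hsum]
    exact congrArg (c * ·) h.hausdorffMeasure_facet_eq
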